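/- Let $X\subseteq\mathbb{R}^n$ be closed and convex, let $m,K,N\ge 1$, let $\|\cdot\|$ be a norm on $\mathbb{R}^p$ with dual norm $\|u\|_*=\sup\{u^T\xi : \|\xi\|\le 1\}$, and let $r>0$. Let $$h(x,\xi)=\max_{1\le k\le K}\{a_k(x)^T\xi+b_k(x)\},$$ where $a_k:\mathbb{R}^n\to\mathbb{R}^p$ and $b_k:\mathbb{R}^n\to\mathbb{R}$ are affine. For $1\le i\le m$ let $$Y_i=\{\xi_i+A_i\zeta : \zeta\in Z_{1i}\},\qquad \Xi=\{\xi_0+A\zeta : \zeta\in Z_2\},$$ where $\xi_0,\xi_i\in\mathbb{R}^p$, $A,A_i\in\mathbb{R}^{p\times L}$, each $Z_{1i}\subseteq\mathbb{R}^L$ is nonempty, compact and convex with $0$ in its relative interior, $Z_2\subseteq\mathbb{R}^L$ is convex, and $Y_i\subseteq\Xi$. Let $\theta_i>0$, and let $\phi_i:\mathbb{R}^p\times\mathbb{R}^p\to\mathbb{R}$ be closed, jointly convex and nonnegative with $\phi_i(\xi,\xi)=0$ for all $\xi$. Let $\hat\xi_1,\dots,\hat\xi_N\in\Xi$, let $\hat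 P_N=\frac1N\sum_{j=1}^N\delta_{\hat\xi_j}$, and let $\mathcal{D}_W$ be the set of Borel probability measures $P$ on $\Xi$ with $E_P\|\xi\|<\infty$ and $W(P,\hat P_N)\le r$, where $$W(P,Q)=\inf_\Pi\int_{\Xi^2}\|\xi-\eta\|\,\Pi(d\xi,d\eta)$$ over all couplings $\Pi$ of $P$ and $Q$. For $x\in X$ put $$V(x)=\sup_{P\in\mathcal{D}_W}E_P\Big[h(x,\xi)-\min_{1\le i\le m}\theta_i\min_{\xi'\in Y_i}\phi_i(\xi,\xi')\Big],$$ where an expectation may be $-\infty$. Write $\delta^*(u|Z)=\sup_{\zeta\in Z}u^T\zeta$ and $\phi_i^{**}(y,y')=\sup_{\xi,\xi'}\{y^T\xi+y'^T\xi'-\phi_i(\xi,\xi')\}$, both with values in $[-\infty,\infty]$. Then the MGDRO model $\inf_{x\in X}V(x)$ is equivalent to the following program in the finitely many variables $x\in\mathbb{R}^n$, $\lambda\in\mathbb{R}$, $s_j\in\mathbb{R}$, $v_{ijk},w_{ijk}\in\mathbb{R}^p$: $$\begin{aligned} \inf\quad & \lambda r+\frac1N\sum_{j=1}^N s_j\\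 \text{s.t.}\quad & \xi_i^Tv_{ijk}+\delta^*(A_i^Tv_{ijk}|Z_{1i})+\xi_0^Tw_{ijk}+\delta^*(A^Tw_{ijk}|Z_2)\\ &\quad-\hat\xi_j^T\big(v_{ijk}+w_{ijk}-a_k(x)\big)+b_k(x)-s_j+\theta_i\phi_i^{**}\Big(\frac{v_{ijk}}{\theta_i},-\frac{v_{ijk}}{\theta_i}\Big)\le 0,\\ &\|v_{ijk}+w_{ijk}-a_k(x)\|_*\le\lambda,\qquad 1\le i\le m,\ 1\le j\le N,\ 1\le k\le K,\\ &\lambda\ge 0,\quad x\in X. \end{aligned}$$ Precisely: the feasible set of the program is convex (and its objective is linear); for every $x\in X$, the value $V(x)$ is finite and is the minimum, attained, of the objective over all feasible $(\lambda,s,v,w)$ for this $x$; the optimal values of the two problems, in $[-\infty,\infty]$, are equal; and $x$ is an optimal solution of the MGDRO model if and only if it is the $x$-component of an optimal solution of the program. -/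

import Mathlib

open MeasureTheory
open scoped ENNReal Matrix

noncomputable section

/-- The affine image `{c + A ζ | ζ ∈ Z}` of a set `Z` of primitive uncertainties. -/
def affineImage {p L : ℕ} (c : Fin p → ℝ) (A : Matrix (Fin p) (Fin L) ℝ)
    (Z : Set (Fin L → ℝ)) : Set (Fin p → ℝ) :=
  (fun ζ => c + A *ᵥ ζ) '' Z

/-- The support function `δ*(u | Z) = sup_{ζ ∈ Z} uᵀζ`, with values in `[-∞, ∞]`; it is the convex
conjugate of the indicator function of `Z`. -/
def supportFun {L : ℕ} (Z : Set (Fin L → ℝ)) (u : Fin L → ℝ) : EReal :=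
  ⨆ ζ ∈ Z, ((u ⬝ᵥ ζ : ℝ) : EReal)

/-- The convex conjugate of a real function with respect to both variables jointly,
`φ**(y, y') = sup_{ξ, ξ'} (yᵀξ + y'ᵀξ' - φ(ξ, ξ'))`, with values in `[-∞, ∞]`. -/
def conjBoth {p : ℕ} (φ : (Fin p → ℝ) → (Fin p → ℝ) → ℝ) (y y' : Fin p → ℝ) : EReal :=
  ⨆ (ξ : Fin p → ℝ) (ξ' : Fin p → ℝ), ((y ⬝ᵥ ξ + y' ⬝ᵥ ξ' - φ ξ ξ' : ℝ) : EReal)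

/-- The dual norm `‖u‖_* = sup {uᵀξ | ‖ξ‖ ≤ 1}` of the norm `ρ`. -/
def dualNorm {p : ℕ} (ρ : Seminorm ℝ (Fin p → ℝ)) (u : Fin p → ℝ) : ℝ :=
  ⨆ ξ : {ξ : Fin p → ℝ // ρ ξ ≤ 1}, u ⬝ᵥ ξ.1

/-- The expectation `E[f⁺] - E[f⁻]` with values in `[-∞, ∞]`. -/
def extExpectation {Ω : Type*} [MeasurableSpace Ω] (P : Measure Ω) (f : Ω → ℝ) : EReal :=
  ((∫⁻ ω, ENNReal.ofReal (f ω) ∂P : ℝ≥0∞) : EReal) -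
    ((∫⁻ ω, ENNReal.ofReal (-f ω) ∂P : ℝ≥0∞) : EReal)

/-- The type-1 Wasserstein distance of two measures on the Borel sets of `S ⊆ ℝᵖ`, for the
transport cost given by the norm `ρ`. -/
def wasserstein {p : ℕ} (ρ : Seminorm ℝ (Fin p → ℝ)) {S : Set (Fin p → ℝ)}
    (P Q : Measure S) : ℝ≥0∞ :=
  ⨅ (π : Measure (S × S)) (_ : π.fst = P ∧ π.snd = Q),
    ∫⁻ z, ENNReal.ofReal (ρ ((z.1 : Fin p → ℝ) - (z.2 : Fin p → ℝ))) ∂π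

/-- The empirical distribution of `N` points. -/
def empiricalMeasure {Ω : Type*} [MeasurableSpace Ω] {N : ℕ} (ω : Fin N → Ω) : Measure Ω :=
  (N : ℝ≥0∞)⁻¹ • ∑ j, Measure.dirac (ω j)

/-- The ball of radius `r` around `Q` for the type-1 Wasserstein distance, in the set of
probability measures on `S` with finite first moment. -/
def wassersteinBall {p : ℕ} (ρ : Seminorm ℝ (Fin p → ℝ)) {S : Set (Fin p → ℝ)}
    (Q : Measure S) (r : ℝ) : Set (Measure S) :=
  {P | IsProbabilityMeasure P ∧ ∫⁻ ξ, ENNReal.ofReal (ρ (ξ : Fin p → ℝ)) ∂P < ∞ ∧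
    wasserstein ρ P Q ≤ ENNReal.ofReal r}

/-- The data of the model: `n` decision variables, uncertain vector in `ℝᵖ`, primitive
uncertainties in `ℝᴸ`, `m` core sets, `K` affine pieces and `N` samples. -/
structure MGDROData (n p L m K N : ℕ) where
  /-- feasible region of the decision -/
  X : Set (Fin n → ℝ)
  /-- slopes of the pieces, affine in the decision -/
  a : Fin K → (Fin n → ℝ) →ᵃ[ℝ] (Fin p → ℝ)
  /-- intercepts of the pieces, affine in the decision -/
  b : Fin K → (Fin n → ℝ) →ᵃ[ℝ] ℝ
  /-- nominal value -/
  ξ₀ : Fin p → ℝ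
  /-- perturbation matrix of the sample space -/
  A₀ : Matrix (Fin p) (Fin L) ℝ
  /-- primitive set of the sample space -/
  Z₂ : Set (Fin L → ℝ)
  /-- centers of the core sets -/
  ξc : Fin m → Fin p → ℝ
  /-- perturbation matrices of the core sets -/
  A : Fin m → Matrix (Fin p) (Fin L) ℝ
  /-- primitive sets of the core sets -/
  Z₁ : Fin m → Set (Fin L → ℝ)
  /-- penalty coefficients -/
  θ : Fin m → ℝ
  /-- distance functions -/
  φ : Fin m → (Fin p → ℝ) → (Fin p → ℝ) → ℝ
  /-- the norm of the Wasserstein distance -/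
  ρ : Seminorm ℝ (Fin p → ℝ)
  /-- radius of the Wasserstein ball -/
  r : ℝ
  /-- the samples, which are points of the sample space -/
  sample : Fin N → affineImage ξ₀ A₀ Z₂

namespace MGDROData

variable {n p L m K N : ℕ} (M : MGDROData n p L m K N)

/-- The sample space `Ξ`. -/
def sampleSpace : Set (Fin p → ℝ) := affineImage M.ξ₀ M.A₀ M.Z₂

/-- The core sets `Y_i`. -/
def coreSet (i : Fin m) : Set (Fin p → ℝ) := affineImage (M.ξc i) (M.A i) (M.Z₁ i)

/-- The piecewise linear objective `h(x, ξ) = max_k (a_k(x)ᵀξ + b_k(x))`. -/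
def h (x : Fin n → ℝ) (ξ : Fin p → ℝ) : ℝ := ⨆ k, (M.a k x ⬝ᵥ ξ + M.b k x)

/-- The penalty `min_i θ_i min_{ξ' ∈ Y_i} φ_i(ξ, ξ')`. -/
def penalty (ξ : Fin p → ℝ) : ℝ := ⨅ i, M.θ i * ⨅ ξ' : M.coreSet i, M.φ i ξ ξ'

/-- The ambiguity set `𝒟_W`. -/
def ambiguitySet : Set (Measure M.sampleSpace) :=
  wassersteinBall M.ρ (S := M.sampleSpace) (empiricalMeasure (Ω := M.sampleSpace) M.sample) M.r

/-- The objective of the MGDRO model: the worst-case expectation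
`sup_{P ∈ 𝒟_W} E_P[h(x, ξ) - min_i θ_i min_{ξ' ∈ Y_i} φ_i(ξ, ξ')]`. -/
def worstCase (x : Fin n → ℝ) : EReal :=
  ⨆ P ∈ M.ambiguitySet, extExpectation P (fun ξ : M.sampleSpace => M.h x ξ - M.penalty ξ)

/-- The decision variables `(x, λ, s, v, w)` of the finite program. -/
abbrev Decision (n p m K N : ℕ) : Type :=
  (Fin n → ℝ) × ℝ × (Fin N → ℝ) × (Fin m → Fin N → Fin K → Fin p → ℝ) ×
    (Fin m → Fin N → Fin K → Fin p → ℝ)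

/-- The constraints of the finite program. -/
def IsFeasible (x : Fin n → ℝ) (lam : ℝ) (s : Fin N → ℝ)
    (v w : Fin m → Fin N → Fin K → Fin p → ℝ) : Prop :=
  x ∈ M.X ∧ 0 ≤ lam ∧
  (∀ i j k,
    ((M.ξc i ⬝ᵥ v i j k : ℝ) : EReal) + supportFun (M.Z₁ i) ((M.A i)ᵀ *ᵥ v i j k)
      + ((M.ξ₀ ⬝ᵥ w i j k : ℝ) : EReal) + supportFun M.Z₂ (M.A₀ᵀ *ᵥ w i j k)
      + ((-((M.sample j : Fin p → ℝ) ⬝ᵥ (v i j k + w i j k - M.a k x))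
            + M.b k x - s j : ℝ) : EReal)
      + (M.θ i : EReal) * conjBoth (M.φ i) ((M.θ i)⁻¹ • v i j k) (-((M.θ i)⁻¹ • v i j k)) ≤ 0) ∧
  ∀ i j k, dualNorm M.ρ (v i j k + w i j k - M.a k x) ≤ lam

/-- The feasible set of the finite program. -/
def feasibleSet : Set (Decision n p m K N) :=
  {z | M.IsFeasible z.1 z.2.1 z.2.2.1 z.2.2.2.1 z.2.2.2.2}

/-- The linear objective `λ r + (1/N) ∑_j s_j` of the finite program. -/
def objective (z : Decision n p m K N) : ℝ :=
  z.2.1 * M.r + (1 / (N : ℝ)) * ∑ j, z.2.2.1 j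

end MGDROData

end

/-!
The worst-case expectation `V(x)` is dualized twice. Both dualities are exact and attained, and
together they produce a feasible point of the program whose objective value is `V(x)`.

The first duality is over the Wasserstein ball. A multiplier `λ ≥ 0` with bounds
`g(ξ) - λ ρ(ξ - ξ̂_j) ≤ s_j` on `Ξ` bounds every expectation of `g` by `λ r + (1/N) ∑ s_j`, by
integration against nearly optimal couplings (`extExpectation_le_of_mem_wassersteinBall`).
Conversely, each choice of `N` points `ξ_j ∈ Ξ` to which the samples are moved has an average cost
and an average gain. Two such choices may be mixed so that the average cost is exactly `r`, and the
mixture then lies in the ball. This is all that is needed for a supporting line at `r` in the plane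
of costs and gains; it exists because `r > 0`, while not moving the samples costs `0`. Its slope is
the multiplier (`exists_multiplier`). No general minimax theorem and no compactness enter.

The integrand `g = h(x, ·) - penalty` is the supremum of the concave functions
`a_k(x)ᵀξ + b_k(x) - θ_i φ_i(ξ, ξ')` over `i`, `k` and `ξ' ∈ Y_i` (`h_sub_penalty_le_iff`), so the
bound by `s_j` is one inequality on `Ξ × Y_i` for each `i`, `j`, `k`. The second duality
(`exists_dual_vectors`) certifies such an inequality by vectors `v`, `w`, through the separation of
a point from an open convex set. The conjugate of `φ_i` at `(y, y')` is finite only if `y' = -y`,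
since `φ_i` vanishes on the diagonal; for this reason a single vector `v` is enough.

The extended-real constraints of the program amount to families of real inequalities that are linear
in the decision variables (`isFeasible_iff`), from which convexity of the feasible set is immediate.
The statements on optimal values and optimal decisions are formal consequences of the
attained equality for each fixed `x`.
-/

/-! ### Extended-real suprema -/

theorem EReal.iSup_add_nonpos_iff {ι : Sort*} (F : ι → EReal) (t : EReal) :
    (⨆ i, F i) + t ≤ 0 ↔ ∀ i, F i + t ≤ 0 := by
  have key : ∀ a : EReal, a + t ≤ 0 ↔ a ≤ 0 - t := fun a =>
    (EReal.le_sub_iff_add_le (Or.inr EReal.zero_ne_bot) (Or.inr EReal.zero_ne_top)).symm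
  simp only [key, iSup_le_iff]

/-- The perspective-type scaling `θ φ**(v/θ, -v/θ)` is the conjugate of `θ φ` at `(v, -v)`. -/
theorem mul_conjBoth_eq {p : ℕ} (φ : (Fin p → ℝ) → (Fin p → ℝ) → ℝ) {θ : ℝ} (hθ : 0 < θ)
    (v : Fin p → ℝ) :
    (θ : EReal) * conjBoth φ (θ⁻¹ • v) (-(θ⁻¹ • v)) =
      ⨆ (ξ : Fin p → ℝ) (ξ' : Fin p → ℝ), ((v ⬝ᵥ ξ - v ⬝ᵥ ξ' - θ * φ ξ ξ' : ℝ) : EReal) := by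
  have h0 : (0 : EReal) < θ := by exact_mod_cast hθ
  refine eq_of_forall_ge_iff fun c => ?_
  have key : ∀ a : EReal, (θ : EReal) * a ≤ c ↔ a ≤ c / θ := fun a => by
    rw [EReal.le_div_iff_mul_le h0 (EReal.coe_ne_top θ), mul_comm]
  rw [key, conjBoth]
  simp only [iSup_le_iff]
  refine forall₂_congr fun ξ ξ' => ?_
  rw [← key, ← EReal.coe_mul]
  refine iff_of_eq (congrArg (fun q : ℝ => (q : EReal) ≤ c) ?_)
  simp only [smul_dotProduct, neg_dotProduct, smul_eq_mul]
  field_simp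
  ring

/-! ### Norms on `ℝᵖ` and their dual norms -/

theorem Seminorm.continuous_pi {p : ℕ} (ρ : Seminorm ℝ (Fin p → ℝ)) : Continuous ρ :=
  continuousOn_univ.mp (ρ.convexOn.continuousOn isOpen_univ)

theorem continuous_dotProduct_left {p : ℕ} (u : Fin p → ℝ) :
    Continuous fun ξ : Fin p → ℝ => u ⬝ᵥ ξ := by
  unfold dotProduct; fun_prop

theorem Seminorm.exists_dotProduct_le {p : ℕ} (ρ : Seminorm ℝ (Fin p → ℝ))
    (hρ : ∀ ξ, ρ ξ = 0 → ξ = 0) (u : Fin p → ℝ) :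
    ∃ C : ℝ, 0 ≤ C ∧ ∀ ξ, u ⬝ᵥ ξ ≤ C * ρ ξ := by
  have hpos : ∀ ξ, ξ ≠ 0 → 0 < ρ ξ := fun ξ hξ =>
    lt_of_le_of_ne (apply_nonneg ρ ξ) fun h => hξ (hρ ξ h.symm)
  have hcont : ContinuousOn (fun ξ => u ⬝ᵥ ξ / ρ ξ) (Metric.sphere (0 : Fin p → ℝ) 1) := by
    refine (continuous_dotProduct_left u).continuousOn.div ρ.continuous_pi.continuousOn ?_
    intro ξ hξ
    exact (hpos ξ (ne_zero_of_mem_unit_sphere ⟨ξ, hξ⟩)).ne'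
  obtain ⟨C, hC⟩ := (isCompact_sphere (0 : Fin p → ℝ) 1).bddAbove_image hcont
  refine ⟨max C 0, le_max_right _ _, fun ξ => ?_⟩
  rcases eq_or_ne ξ 0 with rfl | hξ
  · simp
  have hn : 0 < ‖ξ‖ := norm_pos_iff.mpr hξ
  have h1 : u ⬝ᵥ (‖ξ‖⁻¹ • ξ) / ρ (‖ξ‖⁻¹ • ξ) ≤ C := by
    refine hC ⟨_, ?_, rfl⟩
    simp [norm_smul, hn.ne']
  rw [map_smul_eq_mul, dotProduct_smul, Real.norm_of_nonneg (inv_nonneg.mpr hn.le), smul_eq_mul,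
    mul_div_mul_left _ _ (inv_ne_zero hn.ne'), div_le_iff₀ (hpos ξ hξ)] at h1
  exact h1.trans (mul_le_mul_of_nonneg_right (le_max_left _ _) (apply_nonneg ρ ξ))

theorem dualNorm_le_iff {p : ℕ} (ρ : Seminorm ℝ (Fin p → ℝ)) (hρ : ∀ ξ, ρ ξ = 0 → ξ = 0)
    (u : Fin p → ℝ) {c : ℝ} (hc : 0 ≤ c) :
    dualNorm ρ u ≤ c ↔ ∀ ξ, u ⬝ᵥ ξ ≤ c * ρ ξ := by
  have : Nonempty {ξ : Fin p → ℝ // ρ ξ ≤ 1} := ⟨⟨0, by simp⟩⟩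
  obtain ⟨C, hC0, hC⟩ := ρ.exists_dotProduct_le hρ u
  have hbdd : BddAbove (Set.range fun ξ : {ξ : Fin p → ℝ // ρ ξ ≤ 1} => u ⬝ᵥ ξ.1) := by
    refine ⟨C, ?_⟩
    rintro _ ⟨ξ, rfl⟩
    exact (hC ξ.1).trans (mul_le_of_le_one_right hC0 ξ.2)
  refine ⟨fun h ξ => ?_, fun h => ciSup_le fun ξ => (h ξ.1).trans
    (mul_le_of_le_one_right hc ξ.2)⟩
  rcases (apply_nonneg ρ ξ).eq_or_lt with h0 | hpos
  · rw [hρ ξ h0.symm]; simp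
  have h1 : u ⬝ᵥ ((ρ ξ)⁻¹ • ξ) ≤ c := by
    refine (le_ciSup hbdd ⟨(ρ ξ)⁻¹ • ξ, ?_⟩).trans h
    rw [map_smul_eq_mul, Real.norm_of_nonneg (inv_nonneg.mpr hpos.le), inv_mul_cancel₀ hpos.ne']
  rw [dotProduct_smul, smul_eq_mul, inv_mul_le_iff₀ hpos] at h1
  linarith

namespace MGDROData

variable {n p L m K N : ℕ} (M : MGDROData n p L m K N)

/-! ### Feasibility as a family of linear inequalities -/

theorem _root_.dotProduct_add_dotProduct_transpose {p L : ℕ} (c v : Fin p → ℝ)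
    (A : Matrix (Fin p) (Fin L) ℝ) (ζ : Fin L → ℝ) :
    c ⬝ᵥ v + (Aᵀ *ᵥ v) ⬝ᵥ ζ = v ⬝ᵥ (c + A *ᵥ ζ) := by
  rw [dotProduct_add, Matrix.dotProduct_mulVec, Matrix.mulVec_transpose, dotProduct_comm c v]

/-- Each constraint of the finite program says that four suprema, taken over independent points
of `Y_i`, `Ξ`, `ℝᵖ` and `ℝᵖ`, have a nonpositive sum; equivalently, every choice of those points
gives a nonpositive real number. Sums in `[-∞, ∞]` follow the convention `⊤ + ⊥ = ⊥`, under which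
no hypothesis of nonemptiness is needed. -/
theorem constraint_iff {i : Fin m} (hθ : 0 < M.θ i) (v w : Fin p → ℝ) (c : ℝ) :
    ((M.ξc i ⬝ᵥ v : ℝ) : EReal) + supportFun (M.Z₁ i) ((M.A i)ᵀ *ᵥ v)
      + ((M.ξ₀ ⬝ᵥ w : ℝ) : EReal) + supportFun M.Z₂ (M.A₀ᵀ *ᵥ w) + (c : EReal)
      + (M.θ i : EReal) * conjBoth (M.φ i) ((M.θ i)⁻¹ • v) (-((M.θ i)⁻¹ • v)) ≤ 0 ↔
    ∀ y ∈ M.coreSet i, ∀ z ∈ M.sampleSpace, ∀ ξ ξ' : Fin p → ℝ,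
      v ⬝ᵥ y + w ⬝ᵥ z + c + (v ⬝ᵥ ξ - v ⬝ᵥ ξ' - M.θ i * M.φ i ξ ξ') ≤ 0 := by
  rw [mul_conjBoth_eq _ hθ]
  generalize hT : (⨆ (ξ : Fin p → ℝ) (ξ' : Fin p → ℝ), _ : EReal) = T
  have hsupp : ∀ (Z : Set (Fin L → ℝ)) (u : Fin L → ℝ) (t : EReal),
      supportFun Z u + t ≤ 0 ↔ ∀ ζ ∈ Z, ((u ⬝ᵥ ζ : ℝ) : EReal) + t ≤ 0 := fun Z u t => by
    simp only [supportFun, EReal.iSup_add_nonpos_iff]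
  have e : ∀ a S₁ b S₂ c' T : EReal, a + S₁ + b + S₂ + c' + T = S₁ + (S₂ + (T + (a + b + c'))) := by
    intros; ac_rfl
  have e' : ∀ a b T r : EReal, a + (b + (T + r)) = T + (a + (b + r)) := by
    intros; ac_rfl
  rw [e, hsupp]
  simp only [coreSet, sampleSpace, affineImage, Set.forall_mem_image]
  refine forall₂_congr fun ζ₁ _ => ?_
  rw [add_left_comm, hsupp]
  refine forall₂_congr fun ζ₂ _ => ?_
  rw [e', ← hT]
  simp only [EReal.iSup_add_nonpos_iff]
  refine forall₂_congr fun ξ ξ' => ?_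
  rw [← dotProduct_add_dotProduct_transpose, ← dotProduct_add_dotProduct_transpose]
  norm_cast
  refine iff_of_eq (congrArg (· ≤ 0) ?_)
  ring

/-- Feasibility spelled out by real linear inequalities in the decision variables. -/
theorem isFeasible_iff (hθ : ∀ i, 0 < M.θ i) (hρ : ∀ ξ, M.ρ ξ = 0 → ξ = 0)
    (x : Fin n → ℝ) (lam : ℝ) (s : Fin N → ℝ) (v w : Fin m → Fin N → Fin K → Fin p → ℝ) :
    M.IsFeasible x lam s v w ↔ x ∈ M.X ∧ 0 ≤ lam ∧
      (∀ i j k, ∀ y ∈ M.coreSet i, ∀ z ∈ M.sampleSpace, ∀ ξ ξ' : Fin p → ℝ,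
        v i j k ⬝ᵥ y + w i j k ⬝ᵥ z
          + (-((M.sample j : Fin p → ℝ) ⬝ᵥ (v i j k + w i j k - M.a k x)) + M.b k x - s j)
          + (v i j k ⬝ᵥ ξ - v i j k ⬝ᵥ ξ' - M.θ i * M.φ i ξ ξ') ≤ 0) ∧
      ∀ i j k ξ, (v i j k + w i j k - M.a k x) ⬝ᵥ ξ ≤ lam * M.ρ ξ := by
  unfold IsFeasible
  refine and_congr_right fun _ => and_congr_right fun h0 => and_congr ?_ ?_
  · exact forall_congr' fun i => forall₂_congr fun j k => M.constraint_iff (hθ i) _ _ _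
  · exact forall_congr' fun i => forall₂_congr fun j k => dualNorm_le_iff M.ρ hρ _ h0

theorem convex_feasibleSet (hX : Convex ℝ M.X) (hθ : ∀ i, 0 < M.θ i)
    (hρ : ∀ ξ, M.ρ ξ = 0 → ξ = 0) : Convex ℝ M.feasibleSet := by
  rintro ⟨x, lam, s, v, w⟩ h ⟨x', lam', s', v', w'⟩ h' α β hα hβ hαβ
  simp only [feasibleSet, Set.mem_ofPred_eq, isFeasible_iff M hθ hρ] at h h' ⊢
  obtain ⟨hx, hl, h1, h2⟩ := h
  obtain ⟨hx', hl', h1', h2'⟩ := h'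
  have ha : ∀ k, M.a k (α • x + β • x') = α • M.a k x + β • M.a k x' := fun k =>
    Convex.combo_affine_apply hαβ
  have hb : ∀ k, M.b k (α • x + β • x') = α • M.b k x + β • M.b k x' := fun k =>
    Convex.combo_affine_apply hαβ
  have hβ' : β = 1 - α := by linarith
  refine ⟨hX hx hx' hα hβ hαβ, by simp; positivity, fun i j k y hy z hz ξ ξ' => ?_,
    fun i j k ξ => ?_⟩
  · have H := mul_le_mul_of_nonneg_left (h1 i j k y hy z hz ξ ξ') hα
    have H' := mul_le_mul_of_nonneg_left (h1' i j k y hy z hz ξ ξ') hβ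
    simp only [Prod.smul_mk, Prod.mk_add_mk, Pi.add_apply, Pi.smul_apply, ha, hb,
      add_dotProduct, smul_dotProduct, dotProduct_add, dotProduct_sub, dotProduct_smul,
      smul_eq_mul] at H H' ⊢
    subst hβ'
    linarith
  · have H := mul_le_mul_of_nonneg_left (h2 i j k ξ) hα
    have H' := mul_le_mul_of_nonneg_left (h2' i j k ξ) hβ
    simp only [Prod.smul_mk, Prod.mk_add_mk, Pi.add_apply, Pi.smul_apply, ha,
      add_dotProduct, sub_dotProduct, smul_dotProduct, smul_eq_mul] at H H' ⊢
    linarith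

/-! ### The integrand -/

theorem penalty_inner_bddBelow (hφ : ∀ i ξ ξ', 0 ≤ M.φ i ξ ξ') (i : Fin m) (ξ : Fin p → ℝ) :
    BddBelow (Set.range fun ξ' : M.coreSet i => M.φ i ξ ξ') :=
  ⟨0, by rintro _ ⟨ξ', rfl⟩; exact hφ i ξ ξ'⟩

theorem coreSet_nonempty (hZ₁ : ∀ i, (M.Z₁ i).Nonempty) (i : Fin m) : (M.coreSet i).Nonempty :=
  (hZ₁ i).image _

/-- The integrand is the pointwise supremum of the functions
`ξ ↦ a_k(x)ᵀξ + b_k(x) - θ_i φ_i(ξ, ξ')` over all `i`, `k` and `ξ' ∈ Y_i`. -/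
theorem h_sub_penalty_le_iff (hm : 0 < m) (hK : 0 < K) (hZ₁ : ∀ i, (M.Z₁ i).Nonempty)
    (hθ : ∀ i, 0 < M.θ i) (hφ : ∀ i ξ ξ', 0 ≤ M.φ i ξ ξ') (x : Fin n → ℝ) (ξ : Fin p → ℝ)
    (t : ℝ) :
    M.h x ξ - M.penalty ξ ≤ t ↔ ∀ i k, ∀ ξ' ∈ M.coreSet i,
      M.a k x ⬝ᵥ ξ + M.b k x - M.θ i * M.φ i ξ ξ' ≤ t := by
  have : Nonempty (Fin m) := ⟨⟨0, hm⟩⟩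
  have : Nonempty (Fin K) := ⟨⟨0, hK⟩⟩
  constructor
  · intro h i k ξ' hξ'
    have h1 : M.a k x ⬝ᵥ ξ + M.b k x ≤ M.h x ξ :=
      le_ciSup (f := fun k => M.a k x ⬝ᵥ ξ + M.b k x) (Set.finite_range _).bddAbove k
    have h2 : M.penalty ξ ≤ M.θ i * ⨅ ξ' : M.coreSet i, M.φ i ξ ξ' :=
      ciInf_le (f := fun i => M.θ i * ⨅ ξ' : M.coreSet i, M.φ i ξ ξ')
        (Set.finite_range _).bddBelow i
    have h3 : (⨅ ξ' : M.coreSet i, M.φ i ξ ξ') ≤ M.φ i ξ ξ' :=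
      ciInf_le (M.penalty_inner_bddBelow hφ i ξ) ⟨ξ', hξ'⟩
    have h4 := mul_le_mul_of_nonneg_left h3 (hθ i).le
    linarith
  · intro h
    obtain ⟨k, hk⟩ := exists_eq_ciSup_of_finite (f := fun k => M.a k x ⬝ᵥ ξ + M.b k x)
    obtain ⟨i, hi⟩ := exists_eq_ciInf_of_finite
      (f := fun i => M.θ i * ⨅ ξ' : M.coreSet i, M.φ i ξ ξ')
    have : Nonempty (M.coreSet i) := (M.coreSet_nonempty hZ₁ i).to_subtype
    have h1 : (M.a k x ⬝ᵥ ξ + M.b k x - t) / M.θ i ≤ ⨅ ξ' : M.coreSet i, M.φ i ξ ξ' := by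
      refine le_ciInf fun ξ' => ?_
      rw [div_le_iff₀' (hθ i)]
      linarith [h i k ξ' ξ'.2]
    rw [div_le_iff₀' (hθ i)] at h1
    rw [show M.h x ξ = _ from hk.symm, show M.penalty ξ = _ from hi.symm]
    linarith

theorem _root_.convex_affineImage {p L : ℕ} (c : Fin p → ℝ) (A : Matrix (Fin p) (Fin L) ℝ)
    {Z : Set (Fin L → ℝ)} (hZ : Convex ℝ Z) : Convex ℝ (affineImage c A Z) := by
  have : affineImage c A Z = (fun y => c + y) '' (A.mulVecLin '' Z) := by
    simp [affineImage, Set.image_image]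
  rw [this]
  exact (hZ.linear_image _).translate c

/-- Partial minimization of the jointly convex `φ_i` over the convex set `Y_i` is convex. -/
theorem convexOn_iInf_coreSet (hZ₁ : ∀ i, (M.Z₁ i).Nonempty) (hZ₁c : ∀ i, Convex ℝ (M.Z₁ i))
    (hφ : ∀ i ξ ξ', 0 ≤ M.φ i ξ ξ')
    (hφ_convex : ∀ i, ConvexOn ℝ Set.univ
      (fun z : (Fin p → ℝ) × (Fin p → ℝ) => M.φ i z.1 z.2)) (i : Fin m) :
    ConvexOn ℝ Set.univ fun ξ => ⨅ ξ' : M.coreSet i, M.φ i ξ ξ' := by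
  have : Nonempty (M.coreSet i) := (M.coreSet_nonempty hZ₁ i).to_subtype
  refine ⟨convex_univ, fun ξ _ η _ α β hα hβ hαβ => le_of_forall_pos_le_add fun ε hε => ?_⟩
  obtain ⟨ξ', hξ'⟩ := exists_lt_of_ciInf_lt
    (lt_add_of_pos_right (⨅ ξ' : M.coreSet i, M.φ i ξ ξ') hε)
  obtain ⟨η', hη'⟩ := exists_lt_of_ciInf_lt
    (lt_add_of_pos_right (⨅ ξ' : M.coreSet i, M.φ i η ξ') hε)
  have hmem : α • (ξ' : Fin p → ℝ) + β • (η' : Fin p → ℝ) ∈ M.coreSet i :=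
    convex_affineImage _ _ (hZ₁c i) ξ'.2 η'.2 hα hβ hαβ
  have h1 := ciInf_le (M.penalty_inner_bddBelow hφ i (α • ξ + β • η)) ⟨_, hmem⟩
  have h2 := (hφ_convex i).2 (Set.mem_univ (ξ, (ξ' : Fin p → ℝ)))
    (Set.mem_univ (η, (η' : Fin p → ℝ))) hα hβ hαβ
  simp only [Prod.smul_mk, Prod.mk_add_mk, smul_eq_mul] at h1 h2 ⊢
  have h3 := mul_le_mul_of_nonneg_left hξ'.le hα
  have h4 := mul_le_mul_of_nonneg_left hη'.le hβ
  have h5 : α * ε + β * ε = ε := by rw [← add_mul, hαβ, one_mul]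
  linarith

theorem measurable_h_sub_penalty (hZ₁ : ∀ i, (M.Z₁ i).Nonempty)
    (hZ₁c : ∀ i, Convex ℝ (M.Z₁ i)) (hφ : ∀ i ξ ξ', 0 ≤ M.φ i ξ ξ')
    (hφ_convex : ∀ i, ConvexOn ℝ Set.univ
      (fun z : (Fin p → ℝ) × (Fin p → ℝ) => M.φ i z.1 z.2)) (x : Fin n → ℝ) :
    Measurable fun ξ : Fin p → ℝ => M.h x ξ - M.penalty ξ := by
  refine Measurable.sub (.iSup fun k => ?_) (.iInf fun i => ?_)
  · exact ((continuous_dotProduct_left _).add continuous_const).measurable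
  · refine Measurable.const_mul (Continuous.measurable ?_) _
    exact continuousOn_univ.mp
      ((M.convexOn_iInf_coreSet hZ₁ hZ₁c hφ hφ_convex i).continuousOn isOpen_univ)

/-- The integrand has at most linear growth, because the penalty is nonnegative. -/
theorem exists_linear_growth (hm : 0 < m) (hK : 0 < K) (hZ₁ : ∀ i, (M.Z₁ i).Nonempty)
    (hθ : ∀ i, 0 < M.θ i) (hφ : ∀ i ξ ξ', 0 ≤ M.φ i ξ ξ') (hρ : ∀ ξ, M.ρ ξ = 0 → ξ = 0)
    (x : Fin n → ℝ) :
    ∃ c d : ℝ, 0 ≤ c ∧ ∀ ξ, M.h x ξ - M.penalty ξ ≤ c * M.ρ ξ + d := by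
  choose C hC0 hC using fun k => M.ρ.exists_dotProduct_le hρ (M.a k x)
  refine ⟨∑ k, C k, ∑ k, |M.b k x|, Finset.sum_nonneg fun k _ => hC0 k, fun ξ => ?_⟩
  rw [M.h_sub_penalty_le_iff hm hK hZ₁ hθ hφ]
  intro i k ξ' _
  have h1 : C k ≤ ∑ k, C k := Finset.single_le_sum (fun k _ => hC0 k) (Finset.mem_univ k)
  have h2 : |M.b k x| ≤ ∑ k, |M.b k x| :=
    Finset.single_le_sum (f := fun k => |M.b k x|) (fun k _ => abs_nonneg _) (Finset.mem_univ k)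
  have h3 := mul_le_mul_of_nonneg_right h1 (apply_nonneg M.ρ ξ)
  have h4 := mul_nonneg (hθ i).le (hφ i ξ ξ')
  linarith [hC k ξ, le_abs_self (M.b k x)]

end MGDROData

/-! ### Conjugate duality for one affine piece -/

/-- Conjugate duality for one sample, one core set and one affine piece. If
`aᵀz + b - θ φ(z, y) - λ ρ(z - ξ̂) ≤ s` on `Ξ × Y`, then this bound is certified by dual vectors
`v`, `w`. The certificate comes from separating the origin from the set of all
`(ξ - z, ξ' - y, η - z, t)` with `z ∈ Ξ`, `y ∈ Y` and
`t > θ φ(ξ, ξ') + λ ρ(η - ξ̂) - aᵀz - b + s`. This set is open, `φ` and `ρ` being finite and hence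
continuous, so no constraint qualification on `Ξ` and `Y` is needed. The vanishing of `φ` on the
diagonal forces the two components of the dual variable of `φ` to be opposite. -/
theorem exists_dual_vectors {p : ℕ} {φ : (Fin p → ℝ) → (Fin p → ℝ) → ℝ}
    (hφ_convex : ConvexOn ℝ Set.univ (fun z : (Fin p → ℝ) × (Fin p → ℝ) => φ z.1 z.2))
    (hφ_diag : ∀ ξ, φ ξ ξ = 0) (ρ : Seminorm ℝ (Fin p → ℝ)) {Ξ Y : Set (Fin p → ℝ)}
    (hΞ : Convex ℝ Ξ) (hY : Convex ℝ Y) (hΞ' : Ξ.Nonempty) (hY' : Y.Nonempty)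
    {θ lam : ℝ} (hθ : 0 < θ) (hlam : 0 ≤ lam) (a c : Fin p → ℝ) (b s : ℝ)
    (h : ∀ z ∈ Ξ, ∀ y ∈ Y, a ⬝ᵥ z + b - θ * φ z y - lam * ρ (z - c) ≤ s) :
    ∃ v w : Fin p → ℝ,
      (∀ y ∈ Y, ∀ z ∈ Ξ, ∀ ξ ξ' : Fin p → ℝ,
        v ⬝ᵥ y + w ⬝ᵥ z + (-(c ⬝ᵥ (v + w - a)) + b - s)
          + (v ⬝ᵥ ξ - v ⬝ᵥ ξ' - θ * φ ξ ξ') ≤ 0) ∧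
      ∀ ξ, (v + w - a) ⬝ᵥ ξ ≤ lam * ρ ξ := by
  have hφc : Continuous fun z : (Fin p → ℝ) × (Fin p → ℝ) => φ z.1 z.2 :=
    continuousOn_univ.mp (hφ_convex.continuousOn isOpen_univ)
  have hρc : Continuous ρ := ρ.continuous_pi
  let D : Set ((Fin p → ℝ) × (Fin p → ℝ) × (Fin p → ℝ) × ℝ) :=
    ⋃ z ∈ Ξ, ⋃ y ∈ Y, {d | θ * φ (d.1 + z) (d.2.1 + y)
      + lam * ρ (d.2.2.1 + z - c) - a ⬝ᵥ z - b + s < d.2.2.2}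
  have hmem : ∀ d : (Fin p → ℝ) × (Fin p → ℝ) × (Fin p → ℝ) × ℝ,
      d ∈ D ↔ ∃ z ∈ Ξ, ∃ y ∈ Y, θ * φ (d.1 + z) (d.2.1 + y)
      + lam * ρ (d.2.2.1 + z - c) - a ⬝ᵥ z - b + s < d.2.2.2 := by
    intro d; simp [D]
  have hopen : IsOpen D := by
    refine isOpen_biUnion fun z _ => isOpen_biUnion fun y _ => isOpen_lt ?_ (by fun_prop)
    have h1 : Continuous fun d : (Fin p → ℝ) × (Fin p → ℝ) × (Fin p → ℝ) × ℝ =>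
        φ (d.1 + z) (d.2.1 + y) :=
      hφc.comp (f := fun d : (Fin p → ℝ) × (Fin p → ℝ) × (Fin p → ℝ) × ℝ =>
        (d.1 + z, d.2.1 + y)) (by fun_prop)
    have h2 : Continuous fun d : (Fin p → ℝ) × (Fin p → ℝ) × (Fin p → ℝ) × ℝ =>
        ρ (d.2.2.1 + z - c) := hρc.comp (by fun_prop)
    fun_prop
  have hconv : Convex ℝ D := by
    intro d hd e he α β hα hβ hαβ
    rw [hmem] at hd he ⊢
    obtain ⟨z, hz, y, hy, hd⟩ := hd
    obtain ⟨z', hz', y', hy', he⟩ := he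
    refine ⟨α • z + β • z', hΞ hz hz' hα hβ hαβ, α • y + β • y', hY hy hy' hα hβ hαβ, ?_⟩
    have h1 := hφ_convex.2 (Set.mem_univ (d.1 + z, d.2.1 + y))
      (Set.mem_univ (e.1 + z', e.2.1 + y')) hα hβ hαβ
    have h2 := ρ.convexOn.2 (Set.mem_univ (d.2.2.1 + z - c)) (Set.mem_univ (e.2.2.1 + z' - c))
      hα hβ hαβ
    have hc : c = α • c + β • c := by rw [← add_smul, hαβ, one_smul]
    have e1 : (α • d + β • e).1 + (α • z + β • z') = α • (d.1 + z) + β • (e.1 + z') := by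
      simp only [Prod.fst_add, Prod.smul_fst, smul_add]; abel
    have e2 : (α • d + β • e).2.1 + (α • y + β • y')
        = α • (d.2.1 + y) + β • (e.2.1 + y') := by
      simp only [Prod.fst_add, Prod.smul_fst, Prod.snd_add, Prod.smul_snd, smul_add]; abel
    have e3 : (α • d + β • e).2.2.1 + (α • z + β • z') - c
        = α • (d.2.2.1 + z - c) + β • (e.2.2.1 + z' - c) := by
      conv_lhs => rw [hc]
      simp only [Prod.fst_add, Prod.smul_fst, Prod.snd_add, Prod.smul_snd, smul_add, smul_sub]
      abel
    rw [e1, e2, e3]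
    simp only [Prod.smul_mk, Prod.mk_add_mk, smul_eq_mul, Prod.snd_add, Prod.smul_snd,
      dotProduct_add, dotProduct_smul] at h1 h2 ⊢
    have h1' := mul_le_mul_of_nonneg_left h1 hθ.le
    have h2' := mul_le_mul_of_nonneg_left h2 hlam
    have h3 : α * (θ * φ (d.1 + z) (d.2.1 + y) + lam * ρ (d.2.2.1 + z - c) - a ⬝ᵥ z - b + s)
        + β * (θ * φ (e.1 + z') (e.2.1 + y') + lam * ρ (e.2.2.1 + z' - c) - a ⬝ᵥ z' - b + s)
        < α * d.2.2.2 + β * e.2.2.2 := by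
      rcases hα.eq_or_lt with rfl | hα'
      · rw [zero_add] at hαβ; subst hαβ; linarith
      · exact add_lt_add_of_lt_of_le (mul_lt_mul_of_pos_left hd hα')
          (mul_le_mul_of_nonneg_left he.le hβ)
    have h4 : α * (b - s) + β * (b - s) = b - s := by rw [← add_mul, hαβ, one_mul]
    linarith
  have hzero : (0 : (Fin p → ℝ) × (Fin p → ℝ) × (Fin p → ℝ) × ℝ) ∉ D := by
    rw [hmem]
    rintro ⟨z, hz, y, hy, hd⟩
    have := h z hz y hy
    simp only [Prod.fst_zero, Prod.snd_zero, zero_add] at hd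
    linarith
  obtain ⟨f, hf⟩ := geometric_hahn_banach_point_open hconv hopen hzero
  rw [map_zero] at hf
  have hrep : ∀ ℓ : (Fin p → ℝ) →ₗ[ℝ] ℝ, ∃ q : Fin p → ℝ, ∀ x, ℓ x = q ⬝ᵥ x := fun ℓ =>
    ⟨(dotProductEquiv ℝ (Fin p)).symm ℓ, fun x =>
      (LinearMap.congr_fun ((dotProductEquiv ℝ (Fin p)).apply_symm_apply ℓ) x).symm⟩
  obtain ⟨q₁, hq₁⟩ := hrep (f.toLinearMap ∘ₗ
    LinearMap.inl ℝ (Fin p → ℝ) ((Fin p → ℝ) × (Fin p → ℝ) × ℝ))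
  obtain ⟨q₂, hq₂⟩ := hrep (f.toLinearMap ∘ₗ
    LinearMap.inr ℝ (Fin p → ℝ) ((Fin p → ℝ) × (Fin p → ℝ) × ℝ) ∘ₗ
      LinearMap.inl ℝ (Fin p → ℝ) ((Fin p → ℝ) × ℝ))
  obtain ⟨q₃, hq₃⟩ := hrep (f.toLinearMap ∘ₗ
    LinearMap.inr ℝ (Fin p → ℝ) ((Fin p → ℝ) × (Fin p → ℝ) × ℝ) ∘ₗ
      LinearMap.inr ℝ (Fin p → ℝ) ((Fin p → ℝ) × ℝ) ∘ₗ LinearMap.inl ℝ (Fin p → ℝ) ℝ)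
  obtain ⟨τ, hτ⟩ : ∃ τ : ℝ, ∀ t, f (0, 0, 0, t) = τ * t := by
    refine ⟨f (0, 0, 0, 1), fun t => ?_⟩
    have : ((0, 0, 0, t) : (Fin p → ℝ) × (Fin p → ℝ) × (Fin p → ℝ) × ℝ) =
        t • (0, 0, 0, 1) := by simp
    rw [this, map_smul, smul_eq_mul, mul_comm]
  have hf_eq : ∀ x y z t, f (x, y, z, t) = q₁ ⬝ᵥ x + q₂ ⬝ᵥ y + q₃ ⬝ᵥ z + τ * t := by
    intro x y z t
    rw [← hq₁, ← hq₂, ← hq₃, ← hτ]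
    simp only [LinearMap.comp_apply, LinearMap.inl_apply, LinearMap.inr_apply,
      ContinuousLinearMap.coe_coe, ← map_add]
    simp
  have hsep : ∀ z ∈ Ξ, ∀ y ∈ Y, ∀ ξ ξ' η : Fin p → ℝ, ∀ t,
      θ * φ ξ ξ' + lam * ρ (η - c) - a ⬝ᵥ z - b + s < t →
      0 < q₁ ⬝ᵥ (ξ - z) + q₂ ⬝ᵥ (ξ' - y) + q₃ ⬝ᵥ (η - z) + τ * t := by
    intro z hz y hy ξ ξ' η t ht
    rw [← hf_eq]
    refine hf _ ((hmem _).2 ⟨z, hz, y, hy, ?_⟩)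
    simpa using ht
  obtain ⟨z₀, hz₀⟩ := hΞ'
  obtain ⟨y₀, hy₀⟩ := hY'
  -- Unperturbed points `(z₀, y₀, z₀)` leave only the last coordinate of the functional.
  have hτ_pos : 0 < τ := by
    have h1 := hsep z₀ hz₀ y₀ hy₀ z₀ y₀ z₀
      (max (θ * φ z₀ y₀ + lam * ρ (z₀ - c) - a ⬝ᵥ z₀ - b + s) 0 + 1)
      (by linarith [le_max_left (θ * φ z₀ y₀ + lam * ρ (z₀ - c) - a ⬝ᵥ z₀ - b + s) 0])
    simp only [sub_self, dotProduct_zero, zero_add] at h1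
    exact pos_of_mul_pos_left h1 (by positivity)
  have hmain : ∀ z ∈ Ξ, ∀ y ∈ Y, ∀ ξ ξ' η : Fin p → ℝ,
      0 ≤ (τ⁻¹ • q₁) ⬝ᵥ (ξ - z) + (τ⁻¹ • q₂) ⬝ᵥ (ξ' - y) + (τ⁻¹ • q₃) ⬝ᵥ (η - z)
        + (θ * φ ξ ξ' + lam * ρ (η - c) - a ⬝ᵥ z - b + s) := by
    intro z hz y hy ξ ξ' η
    refine le_of_forall_pos_le_add fun ε hε => ?_
    have h1 := hsep z hz y hy ξ ξ' η _ (lt_add_of_pos_right _ hε)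
    have h2 := mul_pos (inv_pos.mpr hτ_pos) h1
    simp only [mul_add, inv_mul_cancel_left₀ hτ_pos.ne'] at h2
    simp only [smul_dotProduct, smul_eq_mul]
    linarith
  generalize τ⁻¹ • q₁ = q₁ at hmain
  generalize τ⁻¹ • q₂ = q₂ at hmain
  generalize τ⁻¹ • q₃ = q₃ at hmain
  -- An affine function that is nonnegative on a ray has a nonnegative slope.
  have hline : ∀ A B : ℝ, (∀ t : ℝ, 0 ≤ t → 0 ≤ A + t * B) → 0 ≤ B := by
    intro A B hAB
    by_contra! hB
    have h1 := hAB ((|A| + 1) / -B) (div_nonneg (by positivity) (by linarith))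
    have h2 : (|A| + 1) / -B * B = -(|A| + 1) := by
      field_simp [hB.ne]
    linarith [le_abs_self A]
  have hopp : ∀ x : Fin p → ℝ, 0 ≤ (q₁ + q₂) ⬝ᵥ x := by
    intro x
    refine hline (q₁ ⬝ᵥ (-z₀) + q₂ ⬝ᵥ (-y₀) + q₃ ⬝ᵥ (c - z₀) + (-(a ⬝ᵥ z₀) - b + s)) _
      fun t _ => ?_
    have h1 := hmain z₀ hz₀ y₀ hy₀ (t • x) (t • x) c
    rw [hφ_diag, sub_self, map_zero] at h1
    simp only [dotProduct_sub, dotProduct_neg, dotProduct_smul, add_dotProduct,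
      smul_eq_mul] at h1 ⊢
    linarith
  have hq : q₁ = -q₂ := by
    rw [eq_neg_iff_add_eq_zero]
    refine dotProduct_eq_zero _ fun x => le_antisymm ?_ (hopp x)
    have h1 := hopp (-x)
    rw [dotProduct_neg] at h1
    linarith
  have hnorm : ∀ x : Fin p → ℝ, 0 ≤ q₃ ⬝ᵥ x + lam * ρ x := by
    intro x
    refine hline (q₁ ⬝ᵥ (-z₀) + q₂ ⬝ᵥ (-y₀) + q₃ ⬝ᵥ (c - z₀)
      + (-(a ⬝ᵥ z₀) - b + s)) _ fun t ht => ?_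
    have h1 := hmain z₀ hz₀ y₀ hy₀ 0 0 (c + t • x)
    rw [hφ_diag, add_sub_cancel_left, map_smul_eq_mul, Real.norm_of_nonneg ht] at h1
    simp only [dotProduct_sub, dotProduct_neg, dotProduct_smul, dotProduct_add,
      smul_eq_mul, dotProduct_zero] at h1 ⊢
    linarith
  refine ⟨q₂, -q₂ + q₃ + a, fun y hy z hz ξ ξ' => ?_, fun ξ => ?_⟩
  · have h1 := hmain z hz y hy ξ ξ' c
    have h2 : q₂ + (-q₂ + q₃ + a) - a = q₃ := by abel
    rw [sub_self, map_zero, hq] at h1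
    rw [h2, dotProduct_comm c]
    simp only [dotProduct_sub, add_dotProduct, neg_dotProduct] at h1 ⊢
    linarith
  · have h1 := hnorm (-ξ)
    rw [map_neg_eq_map, dotProduct_neg] at h1
    have h2 : q₂ + (-q₂ + q₃ + a) - a = q₃ := by abel
    rw [h2]
    linarith

/-! ### Extended expectations -/

theorem extExpectation_eq_integral {Ω : Type*} [MeasurableSpace Ω] {P : Measure Ω} {f : Ω → ℝ}
    (hf : Integrable f P) : extExpectation P f = ((∫ ω, f ω ∂P : ℝ) : EReal) := by
  have h1 : ∫⁻ ω, ENNReal.ofReal (f ω) ∂P ≠ ⊤ := hf.lintegral_lt_top.ne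
  have h2 : ∫⁻ ω, ENNReal.ofReal (-f ω) ∂P ≠ ⊤ := hf.neg.lintegral_lt_top.ne
  rw [integral_eq_lintegral_pos_part_sub_lintegral_neg_part hf, EReal.coe_sub,
    EReal.coe_ennreal_toReal h1, EReal.coe_ennreal_toReal h2]
  rfl

/-- A measurable function below an integrable one has a well-defined expectation in `[-∞, ∞)`,
which respects the comparison. -/
theorem extExpectation_le_integral {Ω : Type*} [MeasurableSpace Ω] {P : Measure Ω} {f F : Ω → ℝ}
    (hf : Measurable f) (hF : Integrable F P) (h : ∀ ω, f ω ≤ F ω) :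
    extExpectation P f ≤ ((∫ ω, F ω ∂P : ℝ) : EReal) := by
  by_cases hneg : ∫⁻ ω, ENNReal.ofReal (-f ω) ∂P = ⊤
  · simp [extExpectation, hneg]
  · have hpos : ∫⁻ ω, ENNReal.ofReal (f ω) ∂P ≠ ⊤ :=
      ((lintegral_mono fun ω => ENNReal.ofReal_le_ofReal (h ω)).trans_lt hF.lintegral_lt_top).ne
    have hint : Integrable f P := by
      refine ⟨hf.aestronglyMeasurable, ?_⟩
      have h1 : ∀ ω, ‖f ω‖ₑ ≤ ENNReal.ofReal (f ω) + ENNReal.ofReal (-f ω) := fun ω => by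
        rw [Real.enorm_eq_ofReal_abs]
        rcases abs_cases (f ω) with ⟨h, _⟩ | ⟨h, _⟩ <;> rw [h] <;> simp
      refine (lintegral_mono h1).trans_lt ?_
      rw [lintegral_add_left hf.ennreal_ofReal]
      exact ENNReal.add_lt_top.mpr ⟨hpos.lt_top, Ne.lt_top hneg⟩
    rw [extExpectation_eq_integral hint]
    exact_mod_cast integral_mono hint hF h

theorem extExpectation_map {Ω Ω' : Type*} [MeasurableSpace Ω] [MeasurableSpace Ω']
    (π : Measure Ω) {T : Ω → Ω'} (hT : Measurable T) {f : Ω' → ℝ} (hf : Measurable f) :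
    extExpectation (π.map T) f = extExpectation π (fun ω => f (T ω)) := by
  unfold extExpectation
  rw [lintegral_map hf.ennreal_ofReal hT,
    lintegral_map (f := fun ω => ENNReal.ofReal (-f ω)) hf.neg.ennreal_ofReal hT]

/-! ### Empirical measures -/

section Empirical

variable {Ω : Type*} [MeasurableSpace Ω] {N : ℕ}

theorem isProbabilityMeasure_empiricalMeasure (hN : 0 < N) (ω : Fin N → Ω) :
    IsProbabilityMeasure (empiricalMeasure ω) := by
  constructor
  simp [empiricalMeasure,
    ENNReal.inv_mul_cancel (Nat.cast_ne_zero.mpr hN.ne') (ENNReal.natCast_ne_top N)]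

theorem map_empiricalMeasure {Ω' : Type*} [MeasurableSpace Ω'] (ω : Fin N → Ω) {T : Ω → Ω'}
    (hT : Measurable T) :
    (empiricalMeasure ω).map T = empiricalMeasure (fun j => T (ω j)) := by
  simp only [empiricalMeasure, Measure.map_smul, Measure.map_finset_sum hT.aemeasurable,
    Measure.map_dirac' hT]

variable [MeasurableSingletonClass Ω]

theorem integrable_empiricalMeasure (hN : 0 < N) (ω : Fin N → Ω) (f : Ω → ℝ) :
    Integrable f (empiricalMeasure ω) := by
  refine Integrable.smul_measure ?_ (ENNReal.inv_ne_top.mpr (Nat.cast_ne_zero.mpr hN.ne'))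
  exact integrable_finsetSum_measure.mpr fun j _ => integrable_dirac (by simp)

theorem integral_empiricalMeasure (ω : Fin N → Ω) (f : Ω → ℝ) :
    ∫ x, f x ∂empiricalMeasure ω = 1 / (N : ℝ) * ∑ j, f (ω j) := by
  rw [empiricalMeasure, integral_smul_measure,
    integral_finsetSum_measure fun j _ => integrable_dirac (by simp)]
  simp

end Empirical

/-! ### Duality over the Wasserstein ball -/

section Wasserstein

variable {p N : ℕ} (ρ : Seminorm ℝ (Fin p → ℝ)) {S : Set (Fin p → ℝ)}

theorem Seminorm.measurable_sub_coe :
    Measurable fun z : S × S => ρ ((z.1 : Fin p → ℝ) - (z.2 : Fin p → ℝ)) :=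
  ρ.continuous_pi.measurable.comp ((measurable_subtype_coe.comp measurable_fst).sub
    (measurable_subtype_coe.comp measurable_snd))

/-- Weak duality: a multiplier `λ` for the transport budget and bounds `s_j` on
`g - λ ρ(· - ω_j)` bound every expectation over the ball. -/
theorem extExpectation_le_of_mem_wassersteinBall (hN : 0 < N) (ω : Fin N → S) {r : ℝ}
    (hr : 0 ≤ r) {g : S → ℝ} (hg : Measurable g) {lam : ℝ} (hlam : 0 ≤ lam) {s : Fin N → ℝ}
    (hs : ∀ j (ξ : S), g ξ - lam * ρ ((ξ : Fin p → ℝ) - (ω j : Fin p → ℝ)) ≤ s j)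
    {P : Measure S} (hP : P ∈ wassersteinBall ρ (empiricalMeasure ω) r) :
    extExpectation P g ≤ ((lam * r + 1 / (N : ℝ) * ∑ j, s j : ℝ) : EReal) := by
  have : Nonempty (Fin N) := ⟨⟨0, hN⟩⟩
  -- The smallest of the bounds on `g - λ ρ(· - η)` that follow from `hs`. Indexing by `η` instead
  -- of `j` allows for repeated samples.
  let σ : S → ℝ := fun η => ⨅ j, (s j + lam * ρ ((η : Fin p → ℝ) - (ω j : Fin p → ℝ)))
  have hσ_meas : Measurable σ := .iInf fun j =>
    ((ρ.continuous_pi.measurable.comp (measurable_subtype_coe.sub_const _)).const_mul lam).const_add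
      (s j)
  have hσ_le : ∀ j, σ (ω j) ≤ s j := fun j => by
    have h1 : σ (ω j) ≤ s j + lam * ρ ((ω j : Fin p → ℝ) - (ω j : Fin p → ℝ)) :=
      ciInf_le (Set.finite_range _).bddBelow j
    simpa using h1
  have hgσ : ∀ z : S × S, g z.1 ≤ lam * ρ ((z.1 : Fin p → ℝ) - (z.2 : Fin p → ℝ)) + σ z.2 := by
    intro z
    rw [← sub_le_iff_le_add']
    refine le_ciInf fun j => ?_
    have h1 : ρ ((z.1 : Fin p → ℝ) - (ω j : Fin p → ℝ))
        ≤ ρ ((z.1 : Fin p → ℝ) - (z.2 : Fin p → ℝ))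
          + ρ ((z.2 : Fin p → ℝ) - (ω j : Fin p → ℝ)) := by
      rw [← sub_add_sub_cancel (z.1 : Fin p → ℝ) (z.2 : Fin p → ℝ) (ω j : Fin p → ℝ)]
      exact map_add_le_add ρ _ _
    have h2 := mul_le_mul_of_nonneg_left h1 hlam
    linarith [hs j z.1]
  have hbound : ∀ ε : ℝ, 0 < ε →
      extExpectation P g ≤ ((lam * (r + ε) + 1 / (N : ℝ) * ∑ j, s j : ℝ) : EReal) := by
    intro ε hε
    have hlt : wasserstein ρ P (empiricalMeasure ω) < ENNReal.ofReal (r + ε) :=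
      hP.2.2.trans_lt ((ENNReal.ofReal_lt_ofReal_iff (by linarith)).mpr (by linarith))
    simp only [wasserstein, iInf_lt_iff] at hlt
    obtain ⟨π, ⟨hfst, hsnd⟩, hcost⟩ := hlt
    have hcm := ρ.measurable_sub_coe (S := S)
    have hc_int : Integrable
        (fun z : S × S => ρ ((z.1 : Fin p → ℝ) - (z.2 : Fin p → ℝ))) π := by
      refine ⟨hcm.aestronglyMeasurable, ?_⟩
      rw [hasFiniteIntegral_iff_ofReal (.of_forall fun z => apply_nonneg ρ _)]
      exact hcost.trans_le le_top
    have hc_le : ∫ z : S × S, ρ ((z.1 : Fin p → ℝ) - (z.2 : Fin p → ℝ)) ∂π ≤ r + ε := by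
      rw [integral_eq_lintegral_of_nonneg_ae (.of_forall fun z => apply_nonneg ρ _)
        hcm.aestronglyMeasurable]
      exact ENNReal.toReal_le_of_le_ofReal (by linarith) hcost.le
    have hσ_int : Integrable (fun z : S × S => σ z.2) π := by
      have h1 := integrable_empiricalMeasure hN ω σ
      rw [← hsnd] at h1
      exact h1.comp_measurable measurable_snd
    have hσ_eq : ∫ z : S × S, σ z.2 ∂π = 1 / (N : ℝ) * ∑ j, σ (ω j) := by
      rw [← integral_empiricalMeasure, ← hsnd, Measure.snd,
        integral_map measurable_snd.aemeasurable hσ_meas.aestronglyMeasurable]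
    rw [← hfst, Measure.fst, extExpectation_map π measurable_fst hg]
    refine (extExpectation_le_integral (hg.comp measurable_fst)
      ((hc_int.const_mul lam).add hσ_int) hgσ).trans ?_
    have h1 : ∫ z : S × S, ((fun z : S × S => lam * ρ ((z.1 : Fin p → ℝ) - (z.2 : Fin p → ℝ)))
        + fun z : S × S => σ z.2) z ∂π ≤ lam * (r + ε) + 1 / (N : ℝ) * ∑ j, s j := by
      simp only [Pi.add_apply]
      rw [integral_add (hc_int.const_mul lam) hσ_int, integral_const_mul, hσ_eq]
      gcongr with j
      exact hσ_le j
    exact_mod_cast h1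
  refine EReal.le_of_forall_lt_iff_le.mp fun t ht => ?_
  have ht' : lam * r + 1 / (N : ℝ) * ∑ j, s j < t := by exact_mod_cast ht
  refine (hbound ((t - (lam * r + 1 / (N : ℝ) * ∑ j, s j)) / (lam + 1))
    (div_pos (by linarith) (by linarith))).trans ?_
  have h1 : lam * ((t - (lam * r + 1 / (N : ℝ) * ∑ j, s j)) / (lam + 1))
      ≤ t - (lam * r + 1 / (N : ℝ) * ∑ j, s j) := by
    rw [mul_div_assoc', div_le_iff₀ (by linarith)]
    nlinarith
  have h2 : lam * (r + (t - (lam * r + 1 / (N : ℝ) * ∑ j, s j)) / (lam + 1))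
      + 1 / (N : ℝ) * ∑ j, s j ≤ t := by linarith
  exact_mod_cast h2

/-- The supporting line at `r` of the concave envelope of the points `(c i, G i)`, when all
points and two-point mixtures with abscissa `r` lie below `V`. -/
theorem exists_supporting_slope {ι : Type*} (c G : ι → ℝ) {r V : ℝ}
    (h1 : ∀ i, c i ≤ r → G i ≤ V)
    (h2 : ∀ i j, c i < r → r < c j → (c j - r) * G i + (r - c i) * G j ≤ (c j - c i) * V)
    (h3 : ∃ i, c i < r) : ∃ lam : ℝ, 0 ≤ lam ∧ ∀ i, G i ≤ V + lam * (c i - r) := by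
  let T : Set ℝ := insert 0 {t | ∃ j, r < c j ∧ t = (G j - V) / (c j - r)}
  have hT : ∀ i, c i < r → ∀ t ∈ T, t ≤ (V - G i) / (r - c i) := by
    rintro i hi t (rfl | ⟨j, hj, rfl⟩)
    · exact div_nonneg (sub_nonneg.mpr (h1 i hi.le)) (by linarith)
    · rw [div_le_div_iff₀ (by linarith) (by linarith)]
      linarith [h2 i j hi hj]
  have hTb : BddAbove T := h3.elim fun i hi => ⟨_, hT i hi⟩
  refine ⟨sSup T, le_csSup hTb (Set.mem_insert _ _), fun i => ?_⟩
  rcases lt_trichotomy (c i) r with hi | hi | hi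
  · have h4 := csSup_le ⟨0, Set.mem_insert _ _⟩ (hT i hi)
    rw [le_div_iff₀ (by linarith)] at h4
    linarith
  · rw [hi, sub_self, mul_zero, add_zero]
    exact h1 i hi.le
  · have h4 : (G i - V) / (c i - r) ≤ sSup T := le_csSup hTb (Or.inr ⟨i, hi, rfl⟩)
    rw [div_le_iff₀ (by linarith)] at h4
    linarith

/-- A bound on a separable sum splits into bounds on its terms. -/
theorem exists_bounds_of_sum_le {ι X : Type*} [Fintype ι] [Nonempty X]
    (F : ι → X → ℝ) {B : ℝ} (h : ∀ x : ι → X, ∑ j, F j (x j) ≤ B) :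
    ∃ s : ι → ℝ, (∀ j x, F j x ≤ s j) ∧ ∑ j, s j ≤ B := by
  classical
  have hbdd : ∀ j, BddAbove (Set.range (F j)) := by
    intro j
    obtain ⟨x₀⟩ := ‹Nonempty X›
    refine ⟨B - ∑ i ∈ Finset.univ.erase j, F i x₀, ?_⟩
    rintro _ ⟨x, rfl⟩
    have h1 := h (Function.update (fun _ => x₀) j x)
    rw [← Finset.add_sum_erase _ _ (Finset.mem_univ j), Function.update_self,
      Finset.sum_congr rfl fun i hi => by
        rw [Function.update_of_ne (Finset.ne_of_mem_erase hi)]] at h1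
    linarith
  refine ⟨fun j => ⨆ x, F j x, fun j x => le_ciSup (hbdd j) x,
    le_of_forall_pos_le_add fun ε hε => ?_⟩
  have hδ : 0 < ε / (Fintype.card ι + 1) := by positivity
  choose x hx using fun j => exists_lt_of_lt_ciSup (sub_lt_self (⨆ x, F j x) hδ)
  have h1 : ∑ j, ((⨆ x, F j x) - ε / (Fintype.card ι + 1)) ≤ ∑ j, F j (x j) :=
    Finset.sum_le_sum fun j _ => (hx j).le
  rw [Finset.sum_sub_distrib, Finset.sum_const, Finset.card_univ, nsmul_eq_mul] at h1
  have h2 : (Fintype.card ι : ℝ) * (ε / (Fintype.card ι + 1)) ≤ ε := by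
    rw [mul_div_assoc', div_le_iff₀ (by positivity)]
    linarith
  linarith [h x]

/-- Moving the samples to `ξ_j` with probability `1 - τ` and to `η_j` with probability `τ` stays
in the ball as soon as the average transport cost is at most `r`. -/
theorem mixture_mem_wassersteinBall (hN : 0 < N) (ω ξ η : Fin N → S) {r τ : ℝ} (hτ₀ : 0 ≤ τ)
    (hτ₁ : τ ≤ 1)
    (h : (1 - τ) * (1 / (N : ℝ) * ∑ j, ρ ((ξ j : Fin p → ℝ) - (ω j : Fin p → ℝ)))
      + τ * (1 / (N : ℝ) * ∑ j, ρ ((η j : Fin p → ℝ) - (ω j : Fin p → ℝ))) ≤ r) :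
    ENNReal.ofReal (1 - τ) • empiricalMeasure ξ + ENNReal.ofReal τ • empiricalMeasure η
      ∈ wassersteinBall ρ (empiricalMeasure ω) r := by
  have hsum : ENNReal.ofReal (1 - τ) + ENNReal.ofReal τ = 1 := by
    rw [← ENNReal.ofReal_add (by linarith) hτ₀]; simp
  have hξ := isProbabilityMeasure_empiricalMeasure hN ξ
  have hη := isProbabilityMeasure_empiricalMeasure hN η
  refine ⟨⟨by simp [hsum]⟩, ?_, ?_⟩
  · refine Integrable.lintegral_lt_top (f := fun ξ : S => ρ (ξ : Fin p → ℝ)) ?_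
    exact ((integrable_empiricalMeasure hN ξ _).smul_measure ENNReal.ofReal_ne_top).add_measure
      ((integrable_empiricalMeasure hN η _).smul_measure ENNReal.ofReal_ne_top)
  · refine (iInf₂_le (ENNReal.ofReal (1 - τ) • empiricalMeasure (fun j => (ξ j, ω j))
      + ENNReal.ofReal τ • empiricalMeasure (fun j => (η j, ω j))) ⟨?fst, ?snd⟩).trans ?cost
    case fst =>
      simp only [Measure.fst, Measure.map_add _ _ measurable_fst, Measure.map_smul,
        map_empiricalMeasure _ measurable_fst]
    case snd =>
      simp only [Measure.snd, Measure.map_add _ _ measurable_snd, Measure.map_smul,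
        map_empiricalMeasure _ measurable_snd]
      rw [← add_smul, hsum, one_smul]
    case cost =>
      have hi := fun ζ : Fin N → S => integrable_empiricalMeasure hN (fun j => (ζ j, ω j))
        (fun z : S × S => ρ ((z.1 : Fin p → ℝ) - (z.2 : Fin p → ℝ)))
      rw [← ofReal_integral_eq_lintegral_ofReal
        (((hi ξ).smul_measure ENNReal.ofReal_ne_top).add_measure
          ((hi η).smul_measure ENNReal.ofReal_ne_top)) (.of_forall fun z => apply_nonneg ρ _)]
      refine ENNReal.ofReal_le_ofReal (le_of_eq_of_le ?_ h)
      rw [integral_add_measure ((hi ξ).smul_measure ENNReal.ofReal_ne_top)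
        ((hi η).smul_measure ENNReal.ofReal_ne_top), integral_smul_measure,
        integral_smul_measure, integral_empiricalMeasure, integral_empiricalMeasure,
        ENNReal.toReal_ofReal (by linarith), ENNReal.toReal_ofReal hτ₀, smul_eq_mul, smul_eq_mul]

/-- Strong duality with attainment: a bound `V` on the expectations over a ball of positive
radius is certified by a multiplier and bounds `s_j`. -/
theorem exists_multiplier (hN : 0 < N) (ω : Fin N → S) {r : ℝ} (hr : 0 < r) (g : S → ℝ) {V : ℝ}
    (hV : ∀ P ∈ wassersteinBall ρ (empiricalMeasure ω) r, extExpectation P g ≤ (V : EReal)) :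
    ∃ lam : ℝ, 0 ≤ lam ∧ ∃ s : Fin N → ℝ,
      (∀ j (ξ : S), g ξ - lam * ρ ((ξ : Fin p → ℝ) - (ω j : Fin p → ℝ)) ≤ s j) ∧
      lam * r + 1 / (N : ℝ) * ∑ j, s j ≤ V := by
  let c : (Fin N → S) → ℝ := fun ξ =>
    1 / (N : ℝ) * ∑ j, ρ ((ξ j : Fin p → ℝ) - (ω j : Fin p → ℝ))
  let G : (Fin N → S) → ℝ := fun ξ => 1 / (N : ℝ) * ∑ j, g (ξ j)
  have hN' : (0 : ℝ) < N := Nat.cast_pos.mpr hN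
  have hmix : ∀ ξ η τ, 0 ≤ τ → τ ≤ 1 → (1 - τ) * c ξ + τ * c η ≤ r →
      (1 - τ) * G ξ + τ * G η ≤ V := by
    intro ξ η τ h0 h1 h
    have h2 := hV _ (mixture_mem_wassersteinBall ρ hN ω ξ η h0 h1 h)
    have i1 := (integrable_empiricalMeasure hN ξ g).smul_measure
      (ENNReal.ofReal_ne_top (r := 1 - τ))
    have i2 := (integrable_empiricalMeasure hN η g).smul_measure (ENNReal.ofReal_ne_top (r := τ))
    rw [extExpectation_eq_integral (i1.add_measure i2), integral_add_measure i1 i2,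
      integral_smul_measure, integral_smul_measure, integral_empiricalMeasure,
      integral_empiricalMeasure, ENNReal.toReal_ofReal (by linarith), ENNReal.toReal_ofReal h0,
      smul_eq_mul, smul_eq_mul] at h2
    exact_mod_cast h2
  obtain ⟨lam, hlam, h⟩ := exists_supporting_slope c G (r := r) (V := V)
    (fun ξ hξ => by
      have := hmix ξ ξ 0 le_rfl zero_le_one (by linarith)
      linarith)
    (fun ξ η hξ hη => by
      have hd : 0 < c η - c ξ := by linarith
      -- The weight for which the average cost is exactly `r`.
      have h1 := hmix ξ η ((r - c ξ) / (c η - c ξ)) (div_nonneg (by linarith) hd.le)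
        ((div_le_one hd).mpr (by linarith)) (le_of_eq (by field_simp; ring))
      have h2 : (1 - (r - c ξ) / (c η - c ξ)) * G ξ + (r - c ξ) / (c η - c ξ) * G η
          = ((c η - r) * G ξ + (r - c ξ) * G η) / (c η - c ξ) := by field_simp; ring
      rw [h2, div_le_iff₀ hd] at h1
      linarith)
    ⟨ω, by simpa [c] using hr⟩
  have : Nonempty S := ⟨ω ⟨0, hN⟩⟩
  obtain ⟨s, hs, hsum⟩ := exists_bounds_of_sum_le
    (fun j (ξ : S) => g ξ - lam * ρ ((ξ : Fin p → ℝ) - (ω j : Fin p → ℝ)))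
    (B := N * (V - lam * r)) (fun ξ => by
      have h1 : 1 / (N : ℝ) * ∑ j, g (ξ j)
        ≤ V + lam * (1 / (N : ℝ) * ∑ j, ρ ((ξ j : Fin p → ℝ) - (ω j : Fin p → ℝ)) - r) := h ξ
      rw [Finset.sum_sub_distrib, ← Finset.mul_sum]
      have h2 := mul_le_mul_of_nonneg_left h1 hN'.le
      have e1 : ∀ q : ℝ, (N : ℝ) * (1 / N * q) = q := fun q => by field_simp
      have e2 : (N : ℝ) * (V + lam * (1 / (N : ℝ)
          * ∑ j, ρ ((ξ j : Fin p → ℝ) - (ω j : Fin p → ℝ)) - r))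
          = N * (V - lam * r)
            + lam * ∑ j, ρ ((ξ j : Fin p → ℝ) - (ω j : Fin p → ℝ)) := by field_simp; ring
      rw [e1, e2] at h2
      linarith)
  refine ⟨lam, hlam, s, hs, ?_⟩
  have h1 := mul_le_mul_of_nonneg_left hsum (one_div_pos.mpr hN').le
  have e1 : 1 / (N : ℝ) * (N * (V - lam * r)) = V - lam * r := by field_simp
  linarith

end Wasserstein

namespace MGDROData

variable {n p L m K N : ℕ} (M : MGDROData n p L m K N)

/-! ### The finite program and the worst-case expectation -/

/-- Every feasible point bounds the worst-case expectation: taking `y = ξ'` and `z = ξ` in the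
linear form of the constraints cancels the conjugate variable `v`, which leaves
`a_k(x)ᵀξ + b_k(x) - θ_i φ_i(ξ, ξ') - λ ρ(ξ - ξ̂_j) ≤ s_j`. -/
theorem worstCase_le_objective (hm : 0 < m) (hK : 0 < K) (hN : 0 < N)
    (hZ₁ : ∀ i, (M.Z₁ i).Nonempty) (hZ₁c : ∀ i, Convex ℝ (M.Z₁ i)) (hθ : ∀ i, 0 < M.θ i)
    (hφ : ∀ i ξ ξ', 0 ≤ M.φ i ξ ξ')
    (hφ_convex : ∀ i, ConvexOn ℝ Set.univ
      (fun z : (Fin p → ℝ) × (Fin p → ℝ) => M.φ i z.1 z.2))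
    (hρ : ∀ ξ, M.ρ ξ = 0 → ξ = 0) (hr : 0 < M.r) {z : Decision n p m K N}
    (hz : z ∈ M.feasibleSet) : M.worstCase z.1 ≤ (M.objective z : EReal) := by
  obtain ⟨x, lam, s, v, w⟩ := z
  obtain ⟨-, hlam, h1, h2⟩ := (M.isFeasible_iff hθ hρ x lam s v w).1 hz
  have hmeas : Measurable fun ξ : M.sampleSpace => M.h x ξ - M.penalty ξ :=
    (M.measurable_h_sub_penalty hZ₁ hZ₁c hφ hφ_convex x).comp measurable_subtype_coe
  refine iSup₂_le fun P hP => ?_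
  refine extExpectation_le_of_mem_wassersteinBall M.ρ (S := M.sampleSpace) hN M.sample hr.le
    hmeas hlam (s := s) (fun j ξ => ?_) hP
  rw [sub_le_iff_le_add, M.h_sub_penalty_le_iff hm hK hZ₁ hθ hφ]
  intro i k ξ' hξ'
  have h4 := h1 i j k ξ' hξ' ξ ξ.2 ξ ξ'
  have h5 := h2 i j k (-((ξ : Fin p → ℝ) - (M.sample j : Fin p → ℝ)))
  rw [map_neg_eq_map] at h5
  rw [dotProduct_comm (M.sample j : Fin p → ℝ)] at h4
  simp only [dotProduct_neg, dotProduct_sub, add_dotProduct, sub_dotProduct] at h4 h5 ⊢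
  linarith

/-- The worst-case expectation is real: the empirical measure bounds it from below, and the linear
growth of the integrand bounds it from above. -/
theorem worstCase_ne_bot_ne_top (hm : 0 < m) (hK : 0 < K) (hN : 0 < N)
    (hZ₁ : ∀ i, (M.Z₁ i).Nonempty) (hZ₁c : ∀ i, Convex ℝ (M.Z₁ i)) (hθ : ∀ i, 0 < M.θ i)
    (hφ : ∀ i ξ ξ', 0 ≤ M.φ i ξ ξ')
    (hφ_convex : ∀ i, ConvexOn ℝ Set.univ
      (fun z : (Fin p → ℝ) × (Fin p → ℝ) => M.φ i z.1 z.2))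
    (hρ : ∀ ξ, M.ρ ξ = 0 → ξ = 0) (hr : 0 < M.r) (x : Fin n → ℝ) :
    M.worstCase x ≠ ⊥ ∧ M.worstCase x ≠ ⊤ := by
  constructor
  · have h1 : empiricalMeasure (Ω := M.sampleSpace) M.sample ∈ M.ambiguitySet := by
      have h2 := mixture_mem_wassersteinBall M.ρ (S := M.sampleSpace) hN M.sample M.sample
        M.sample (r := M.r) le_rfl zero_le_one (by simpa using hr.le)
      rwa [sub_zero, ENNReal.ofReal_one, ENNReal.ofReal_zero, one_smul, zero_smul, add_zero] at h2
    have h2 : extExpectation (empiricalMeasure (Ω := M.sampleSpace) M.sample)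
        (fun ξ : M.sampleSpace => M.h x ξ - M.penalty ξ) ≤ M.worstCase x :=
      le_iSup₂_of_le _ h1 le_rfl
    have h3 := extExpectation_eq_integral (integrable_empiricalMeasure (Ω := M.sampleSpace) hN
      M.sample (fun ξ => M.h x ξ - M.penalty ξ))
    exact ne_bot_of_le_ne_bot (h3.trans_ne (EReal.coe_ne_bot _)) h2
  · obtain ⟨c, d, hc, hcd⟩ := M.exists_linear_growth hm hK hZ₁ hθ hφ hρ x
    have hmeas : Measurable fun ξ : M.sampleSpace => M.h x ξ - M.penalty ξ :=
      (M.measurable_h_sub_penalty hZ₁ hZ₁c hφ hφ_convex x).comp measurable_subtype_coe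
    refine ne_top_of_le_ne_top (EReal.coe_ne_top (c * M.r
      + 1 / (N : ℝ) * ∑ j, (c * M.ρ (M.sample j : Fin p → ℝ) + d))) (iSup₂_le fun P hP => ?_)
    refine extExpectation_le_of_mem_wassersteinBall M.ρ (S := M.sampleSpace) hN M.sample hr.le
      hmeas hc (fun j ξ => ?_) hP
    have h1 : M.ρ (ξ : Fin p → ℝ) ≤ M.ρ ((ξ : Fin p → ℝ) - (M.sample j : Fin p → ℝ))
        + M.ρ (M.sample j : Fin p → ℝ) := by
      simpa using map_add_le_add M.ρ ((ξ : Fin p → ℝ) - (M.sample j : Fin p → ℝ))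
        (M.sample j : Fin p → ℝ)
    have h2 := mul_le_mul_of_nonneg_left h1 hc
    have h3 := hcd ξ
    linarith

/-- The value `V(x)` is reached by a feasible point: `(λ, s)` is the multiplier of the Wasserstein
ball, and `(v, w)` certifies the bounds `s_j` piece by piece. -/
theorem exists_feasible_objective_le (hm : 0 < m) (hK : 0 < K) (hN : 0 < N)
    (hZ₂c : Convex ℝ M.Z₂) (hZ₁ : ∀ i, (M.Z₁ i).Nonempty) (hZ₁c : ∀ i, Convex ℝ (M.Z₁ i))
    (hθ : ∀ i, 0 < M.θ i) (hφ : ∀ i ξ ξ', 0 ≤ M.φ i ξ ξ')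
    (hφ_convex : ∀ i, ConvexOn ℝ Set.univ
      (fun z : (Fin p → ℝ) × (Fin p → ℝ) => M.φ i z.1 z.2))
    (hφ_diag : ∀ i ξ, M.φ i ξ ξ = 0) (hρ : ∀ ξ, M.ρ ξ = 0 → ξ = 0) (hr : 0 < M.r)
    {x : Fin n → ℝ} (hx : x ∈ M.X) :
    ∃ z ∈ M.feasibleSet, z.1 = x ∧ (M.objective z : EReal) ≤ M.worstCase x := by
  obtain ⟨hbot, htop⟩ :=
    M.worstCase_ne_bot_ne_top hm hK hN hZ₁ hZ₁c hθ hφ hφ_convex hρ hr x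
  have hV := EReal.coe_toReal htop hbot
  obtain ⟨lam, hlam, s, hs, hle⟩ := exists_multiplier M.ρ (S := M.sampleSpace) hN M.sample hr
    (fun ξ : M.sampleSpace => M.h x ξ - M.penalty ξ) (V := (M.worstCase x).toReal)
    (fun P hP => by rw [hV]; exact le_iSup₂_of_le P hP le_rfl)
  have hdual := fun i j k => exists_dual_vectors (hφ_convex i) (hφ_diag i) M.ρ
    (convex_affineImage M.ξ₀ M.A₀ hZ₂c) (convex_affineImage (M.ξc i) (M.A i) (hZ₁c i))
    ⟨_, (M.sample ⟨0, hN⟩).2⟩ (M.coreSet_nonempty hZ₁ i) (hθ i) hlam (M.a k x)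
    (M.sample j : Fin p → ℝ) (M.b k x) (s j) (fun z hz y hy => by
      have h1 := hs j ⟨z, hz⟩
      rw [sub_le_iff_le_add, M.h_sub_penalty_le_iff hm hK hZ₁ hθ hφ] at h1
      linarith [h1 i k y hy])
  choose v w hv hw using hdual
  refine ⟨(x, lam, s, v, w), (M.isFeasible_iff hθ hρ x lam s v w).2 ⟨hx, hlam, hv, hw⟩, rfl, ?_⟩
  rw [← hV]
  exact_mod_cast hle

end MGDROData

theorem theorem2 {n p L m K N : ℕ} (hm : 0 < m) (hK : 0 < K) (hN : 0 < N)
    (M : MGDROData n p L m K N)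
    (hX_closed : IsClosed M.X) (hX_convex : Convex ℝ M.X)
    (hZ₂_convex : Convex ℝ M.Z₂)
    (hZ₁_nonempty : ∀ i, (M.Z₁ i).Nonempty)
    (hZ₁_compact : ∀ i, IsCompact (M.Z₁ i))
    (hZ₁_convex : ∀ i, Convex ℝ (M.Z₁ i))
    (hZ₁_zero : ∀ i, (0 : Fin L → ℝ) ∈ intrinsicInterior ℝ (M.Z₁ i))
    (h_core : ∀ i, M.coreSet i ⊆ M.sampleSpace)
    (hθ : ∀ i, 0 < M.θ i)
    (hφ_closed : ∀ i, LowerSemicontinuous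
      (fun z : (Fin p → ℝ) × (Fin p → ℝ) => M.φ i z.1 z.2))
    (hφ_convex : ∀ i, ConvexOn ℝ Set.univ
      (fun z : (Fin p → ℝ) × (Fin p → ℝ) => M.φ i z.1 z.2))
    (hφ_nonneg : ∀ i ξ ξ', 0 ≤ M.φ i ξ ξ')
    (hφ_diag : ∀ i ξ, M.φ i ξ ξ = 0)
    (hρ : ∀ ξ, M.ρ ξ = 0 → ξ = 0)
    (hr : 0 < M.r) :
    -- the finite program is convex
    Convex ℝ M.feasibleSet ∧
    -- for every decision the worst-case expectation is the minimum over the other variables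
    (∀ x ∈ M.X, IsLeast
      {t : EReal | ∃ z ∈ M.feasibleSet, z.1 = x ∧ t = (M.objective z : EReal)}
      (M.worstCase x)) ∧
    -- the optimal values agree
    (⨅ x ∈ M.X, M.worstCase x) = (⨅ z ∈ M.feasibleSet, (M.objective z : EReal)) ∧
    -- the optimal decisions agree
    (∀ x, (x ∈ M.X ∧ IsMinOn M.worstCase M.X x) ↔
      ∃ z ∈ M.feasibleSet, z.1 = x ∧ IsMinOn M.objective M.feasibleSet z) := by
  have hmin : ∀ x ∈ M.X, IsLeast
      {t : EReal | ∃ z ∈ M.feasibleSet, z.1 = x ∧ t = (M.objective z : EReal)}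
      (M.worstCase x) := by
    intro x hx
    constructor
    · obtain ⟨z, hz, hzx, hle⟩ := M.exists_feasible_objective_le hm hK hN hZ₂_convex
        hZ₁_nonempty hZ₁_convex hθ hφ_nonneg hφ_convex hφ_diag hρ hr hx
      refine ⟨z, hz, hzx, le_antisymm ?_ hle⟩
      rw [← hzx]
      exact M.worstCase_le_objective hm hK hN hZ₁_nonempty hZ₁_convex hθ hφ_nonneg hφ_convex
        hρ hr hz
    · rintro _ ⟨z, hz, rfl, rfl⟩
      exact M.worstCase_le_objective hm hK hN hZ₁_nonempty hZ₁_convex hθ hφ_nonneg hφ_convex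
        hρ hr hz
  refine ⟨M.convex_feasibleSet hX_convex hθ hρ, hmin, le_antisymm ?_ ?_, fun x => ⟨?_, ?_⟩⟩
  · exact le_iInf₂ fun z hz => (iInf₂_le z.1 hz.1).trans ((hmin z.1 hz.1).2 ⟨z, hz, rfl, rfl⟩)
  · refine le_iInf₂ fun x hx => ?_
    obtain ⟨z, hz, -, hzV⟩ := (hmin x hx).1
    rw [hzV]
    exact iInf₂_le z hz
  · rintro ⟨hx, hopt⟩
    obtain ⟨z, hz, hzx, hzV⟩ := (hmin x hx).1
    refine ⟨z, hz, hzx, fun z' hz' => EReal.coe_le_coe_iff.mp ?_⟩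
    rw [← hzV]
    exact (hopt hz'.1).trans ((hmin z'.1 hz'.1).2 ⟨z', hz', rfl, rfl⟩)
  · rintro ⟨z, hz, rfl, hopt⟩
    refine ⟨hz.1, fun x' hx' => ?_⟩
    obtain ⟨z', hz', -, hzV'⟩ := (hmin x' hx').1
    refine ((hmin z.1 hz.1).2 ⟨z, hz, rfl, rfl⟩).trans ?_
    rw [hzV']
    exact EReal.coe_le_coe_iff.mpr (hopt hz')
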